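/- A \emph{partially ordered generalized pattern} $P$ is a finite word $p_1p_2\cdots p_m$ in the positive integers, in which letters may repeat, with a dash written between some of its consecutive letters; $P'$ denotes the word $p_1\cdots p_m$ without dashes. Patterns are normalized: the set of letters of $P$ is $\{1,2,\dots,r\}$ for some $r$. A pattern is \emph{contiguous} if it has no dashes, and \emph{nontrivial} if at least two different letters occur in it. An \emph{occurrence} of $P$ in a permutation $\pi=a_1a_2\cdots a_n$ of $\{1,\dots,n\}$ is a choice of positions $1\le k_1<\dots<k_m\le n$ such that $p_i>p_j$ implies $a_{k_i}>a_{k_j}$ for all $i,j$ (equal letters impose no condition on each other), and $k_{i+1}=k_i+1$ whenever $p_i$ and $p_{i+1}$ are not separated by a dash. Let $\mathrm{Av}(P)$ be the set of all permutations, of all lengths $n\ge 0$, in which $P$ has no occurrence. Let $P=\sigma_1\text{-}\sigma_2\text{-}\sigma_3\text{-}\sigma_4$ and $Q=\sigma_1\text{-}\sigma_2\sigma_3\text{-}\sigma_4$ be nontrivial (normalized) partially ordered generalized patterns, where $\sigma_2$ and $\sigma_3$ are nonempty and contiguous, and $\sigma_1$ and $\sigma_4$ may contain dashes and may be empty (in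 which case the dash next to them is dropped). Suppose (as one may by symmetry) that the last letter of $\sigma_2$ is less than or equal to the first letter of $\sigma_3$. Then $\mathrm{Av}(P)=\mathrm{Av}(Q)$ if and only if $P$ has one of the following properties, where $x\dots x$ denotes one or more copies of the letter $x$ and $A^*$ denotes the set of words over $A$: (1) $\sigma_2=1\dots1$, $\sigma_3=2$, and $P'\in\{1,2\}^*$; (2) $\sigma_2=1$, $\sigma_3=2\dots2$, and $P'\in\{1,2\}^*$; (3) $\sigma_2=2\dots21$, $\sigma_3=2\dots2$, $P'\in\{1,2\}^*$, and the letter $1$ appears exactly once in $P$; (4) $\sigma_2=1\dots1$, $\sigma_3=21\dots1$, $P'\in\{1,2\}^*$, and the letter $2$ appears exactly once in $P$; (5) $\sigma_2=1\dots1$, $\sigma_3=3$, $P'\in\{1,2,3\}^*$, and the letter $2$ appears exactly once in $P$; (6) $\sigma_2=1$, $\sigma_3=3\dots3$, $P'\in\{1,2,3\}^*$, and the letter $2$ appears exactly once in $P$. -/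

import Mathlib

/-- A partially ordered generalized pattern: a word in the positive integers with dashes between
some of its letters, recorded as the list of its maximal dash-free (contiguous) nonempty segments.
For instance `2-13` has the blocks `[[2], [1, 3]]`. The empty pattern has no blocks. -/
structure POGPattern where
  blocks : List (List ℕ)
  blocks_ne_nil : ∀ b ∈ blocks, b ≠ []

namespace POGPattern

/-- The underlying permutation of the multiset of letters (all dashes removed). -/
def word (P : POGPattern) : List ℕ := P.blocks.flatten

/-- The pattern without dashes (contiguous pattern) with a given nonempty word. -/
def contiguous (w : List ℕ) (hw : w ≠ []) : POGPattern where
  blocks := [w]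
  blocks_ne_nil := by simpa using hw

/-- `P.dash Q` is the pattern `P`-`Q`: the two patterns are juxtaposed, separated by a dash
(there is no dash if one of the two patterns is empty). -/
def dash (P Q : POGPattern) : POGPattern where
  blocks := P.blocks ++ Q.blocks
  blocks_ne_nil := by
    intro b hb
    rcases List.mem_append.1 hb with h | h
    · exact P.blocks_ne_nil b h
    · exact Q.blocks_ne_nil b h

/-- For `0 < i < P.word.length`: there is a dash directly after the first `i` letters of `P`. -/
def DashAfter (P : POGPattern) (i : ℕ) : Prop :=
  ∃ A B : List (List ℕ), P.blocks = A ++ B ∧ A.flatten.length = i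

/-- The letters of `π = a₁ a₂ … aₙ` at the increasing positions `k` form an occurrence of `P`:
a larger letter of `P` is represented by a larger element of `π` (equal letters impose no
condition on each other), and consecutive letters of `P` that are not separated by a dash are
represented by adjacent elements of `π`. -/
structure IsOccurrence (P : POGPattern) {n : ℕ} (π : Equiv.Perm (Fin n))
    (k : Fin P.word.length → Fin n) : Prop where
  strictMono : StrictMono k
  order : ∀ i j, P.word.get j < P.word.get i → π (k j) < π (k i)
  adjacent : ∀ i j : Fin P.word.length, (j : ℕ) = (i : ℕ) + 1 → ¬ P.DashAfter j →
    (k j : ℕ) = (k i : ℕ) + 1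

/-- The permutation `π` avoids `P`. -/
def Avoids {n : ℕ} (π : Equiv.Perm (Fin n)) (P : POGPattern) : Prop :=
  ¬ ∃ k : Fin P.word.length → Fin n, P.IsOccurrence π k

/-- The set of all permutations, of any length `n ≥ 0`, that avoid `P`. -/
def Av (P : POGPattern) : Set (Σ n : ℕ, Equiv.Perm (Fin n)) :=
  {π | Avoids π.2 P}

/-- The letters occurring in `P` are exactly `1, 2, …, m` for some `m`. -/
def Normalized (P : POGPattern) : Prop :=
  ∃ m : ℕ, ∀ x : ℕ, x ∈ P.word ↔ 1 ≤ x ∧ x ≤ m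

/-- At least two different letters occur in `P`. -/
def Nontrivial (P : POGPattern) : Prop :=
  ∃ x ∈ P.word, ∃ y ∈ P.word, x ≠ y

/-- All letters of `P` belong to `A`, i.e. `P' ∈ A*`. -/
def LettersIn (P : POGPattern) (A : Set ℕ) : Prop :=
  ∀ x ∈ P.word, x ∈ A

end POGPattern

/-! An occurrence of `Q` is an occurrence of `P`, so the theorem asks when every permutation
containing `P` contains `Q`. Let σ₂ occupy the indices `[s, c)` and σ₃ the indices `[c, e)`.

If `P` has one of the six shapes, the letters outside σ₂ and σ₃ stay where they are and the two
blocks slide into one window inside the stretch they span (`slide`). In (1), (2), (5), (6) the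
entries are sorted into value classes, one per letter; every entry between the blocks has the class
of σ₂ or of σ₃, and the window is placed where the class first, or last, changes. In (3) and (4) the
exceptional letter moves to an extremal entry of the gap.

Conversely, realize `P` by its own word, with ties refined, and insert one entry at the gap
(`Forces.insert`). An occurrence of `Q` misses exactly one position, outside the interior of the
merged block, so the inserted entry must play the first letter of σ₃ or the last letter of σ₂.
Extreme values force these letters to be the maximum `m` and 1; intermediate values leave at most
one intermediate letter and make both blocks constant if there is one; for `m = 2`, tie-breaking
makes the exceptional letter unique if a block is not constant. When both blocks are constant,
inserting a large and then a small entry forces one block to be a single letter. -/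

/-! ### Occurrences in sequences of natural numbers -/

/-- Occurrence of a pattern with letters `u 0, …, u (l - 1)` and dashes after the positions in `d`,
in the sequence `g 0, …, g (n - 1)`, at the positions `k 0 < ⋯ < k (l - 1)`. -/
structure OccursAt (u : ℕ → ℕ) (l : ℕ) (d : ℕ → Prop) (n : ℕ) (g k : ℕ → ℕ) : Prop where
  mono : ∀ i j, i < j → j < l → k i < k j
  lt : ∀ i, i < l → k i < n
  order : ∀ i j, i < l → j < l → u j < u i → g (k j) < g (k i)
  adjacent : ∀ i, i + 1 < l → ¬ d (i + 1) → k (i + 1) = k i + 1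

/-- The dashes `dQ` are the dashes `dP` without the one at `c`, and `[s, e)` is the block of `dQ`
around `c`, in a pattern of length `l`. -/
structure MergesAt (s c e l : ℕ) (dP dQ : ℕ → Prop) : Prop where
  left_lt : s < c
  lt_right : c < e
  right_le : e ≤ l
  dash_iff : ∀ j, dP j ↔ j = c ∨ dQ j
  dash_left : dQ s
  dash_right : dQ e
  no_dash : ∀ j, s < j → j < e → ¬ dQ j

namespace OccursAt

variable {u : ℕ → ℕ} {l n : ℕ} {d dP dQ : ℕ → Prop} {g k : ℕ → ℕ} {s c e : ℕ}

theorem add_sub_le (h : OccursAt u l d n g k) {i j : ℕ} (hij : i ≤ j) (hj : j < l) :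
    k i + (j - i) ≤ k j := by
  induction j, hij using Nat.le_induction with
  | base => simp
  | succ j hij ih =>
    have := ih (by omega)
    have := h.mono j (j + 1) (by omega) hj
    omega

theorem eq_add_of_no_dash (h : OccursAt u l d n g k) {a b : ℕ} (hb : b ≤ l)
    (hd : ∀ i, a < i → i < b → ¬ d i) {j : ℕ} (haj : a ≤ j) (hj : j < b) :
    k j = k a + (j - a) := by
  induction j, haj using Nat.le_induction with
  | base => simp
  | succ j hij ih =>
    have := ih (by omega)
    have := h.adjacent j (by omega) (hd _ (by omega) hj)
    omega

theorem left_block (h : OccursAt u l dP n g k) (M : MergesAt s c e l dP dQ) {j : ℕ} (h1 : s ≤ j)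
    (h2 : j < c) : k j = k s + (j - s) := by
  have := M.lt_right
  have := M.right_le
  refine h.eq_add_of_no_dash (b := c) (by omega) (fun i hi hi' hd => ?_) h1 h2
  rcases (M.dash_iff i).1 hd with h | h
  · omega
  · exact M.no_dash i hi (by omega) h

theorem right_block (h : OccursAt u l dP n g k) (M : MergesAt s c e l dP dQ) {j : ℕ} (h1 : c ≤ j)
    (h2 : j < e) : k j = k c + (j - c) := by
  have := M.left_lt
  have := M.right_le
  refine h.eq_add_of_no_dash (b := e) (by omega) (fun i hi hi' hd => ?_) h1 h2
  rcases (M.dash_iff i).1 hd with h | h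
  · omega
  · exact M.no_dash i (by omega) (by omega) h

/-! ### Sufficiency: sliding the two blocks together -/

/-- Moving the two blocks around `c` into a window of adjacent positions between them. -/
theorem slide (h : OccursAt u l dP n g k) (M : MergesAt s c e l dP dQ) {a : ℕ} {k' : ℕ → ℕ}
    (ha : k s ≤ a) (hb : a + (e - s) ≤ k (e - 1) + 1)
    (hin : ∀ j, s ≤ j → j < e → k' j = a + (j - s))
    (hout : ∀ j, j < s ∨ e ≤ j → k' j = k j)
    (hord : ∀ i j, i < l → j < l → u j < u i → g (k' j) < g (k' i)) :
    OccursAt u l dQ n g k' := by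
  have h1 := M.left_lt
  have h2 := M.lt_right
  have h3 := M.right_le
  refine ⟨fun i j hij hj => ?_, fun i hi => ?_, hord, fun i hi hd => ?_⟩
  · rcases lt_or_ge i s with his | his
    · rw [hout i (Or.inl his)]
      rcases lt_or_ge j s with hjs | hjs
      · rw [hout j (Or.inl hjs)]; exact h.mono _ _ hij hj
      · have := h.mono i s his (by omega)
        rcases lt_or_ge j e with hje | hje
        · rw [hin j hjs hje]; omega
        · rw [hout j (Or.inr hje)]; exact h.mono _ _ hij hj
    · rcases lt_or_ge i e with hie | hie
      · rw [hin i his hie]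
        rcases lt_or_ge j e with hje | hje
        · rw [hin j (by omega) hje]; omega
        · rw [hout j (Or.inr hje)]
          have := h.mono (e - 1) j (by omega) hj
          omega
      · rw [hout i (Or.inr hie), hout j (Or.inr (by omega))]; exact h.mono _ _ hij hj
  · by_cases hi' : s ≤ i ∧ i < e
    · rw [hin i hi'.1 hi'.2]
      have := h.lt (e - 1) (by omega)
      omega
    · rw [hout i (by omega)]; exact h.lt i hi
  · have hs : i + 1 ≠ s := fun h => hd (h ▸ M.dash_left)
    have he : i + 1 ≠ e := fun h => hd (h ▸ M.dash_right)
    by_cases hi' : s ≤ i ∧ i < e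
    · rw [hin i hi'.1 hi'.2, hin (i + 1) (by omega) (by omega)]; omega
    · rw [hout i (by omega), hout (i + 1) (by omega)]
      refine h.adjacent i hi fun hP => ?_
      rcases (M.dash_iff _).1 hP with h | h
      · omega
      · exact hd h

/-- `slide` when the letters are read off from a classification `cl` of the positions. -/
theorem exists_of_class (h : OccursAt u l dP n g k) (M : MergesAt s c e l dP dQ) {cl : ℕ → ℕ}
    (hcl : ∀ p q, p < n → q < n → cl p < cl q → g p < g q) (hk : ∀ j, j < l → cl (k j) = u j)
    {a : ℕ} (ha : k s ≤ a) (hb : a + (e - s) ≤ k (e - 1) + 1)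
    (hin : ∀ j, s ≤ j → j < e → cl (a + (j - s)) = u j) :
    ∃ k', OccursAt u l dQ n g k' := by
  have h3 := M.right_le
  have h4 := M.left_lt
  have h5 := M.lt_right
  have hn := h.lt (e - 1) (by omega)
  have key : ∀ j, j < l → cl (if s ≤ j ∧ j < e then a + (j - s) else k j) = u j ∧
      (if s ≤ j ∧ j < e then a + (j - s) else k j) < n := by
    intro j hj
    split_ifs with hj'
    · exact ⟨hin j hj'.1 hj'.2, by omega⟩
    · exact ⟨hk j hj, h.lt j hj⟩
  refine ⟨fun j => if s ≤ j ∧ j < e then a + (j - s) else k j, h.slide M ha hb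
    (fun j h1 h2 => if_pos ⟨h1, h2⟩) (fun j hj => if_neg (by omega)) fun i j hi hj hij => ?_⟩
  apply hcl _ _ (key j hj).2 (key i hi).2
  rw [(key j hj).1, (key i hi).1]
  exact hij

/-- The window ends at the first position of class `y` after the σ₂ block. By minimality everything
before it in the gap has class `x`, as has the σ₂ block itself. -/
theorem exists_of_right_singleton (h : OccursAt u l dP n g k) (M : MergesAt s c e l dP dQ)
    {cl : ℕ → ℕ}
    (hcl : ∀ p q, p < n → q < n → cl p < cl q → g p < g q) (hk : ∀ j, j < l → cl (k j) = u j)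
    {x y : ℕ} (hx : ∀ j, s ≤ j → j < c → u j = x) (he : e = c + 1) (hy : u c = y)
    (hmid : ∀ p, k (c - 1) < p → p < k c → cl p = x ∨ cl p = y) :
    ∃ k', OccursAt u l dQ n g k' := by
  classical
  have h3 := M.right_le
  have h4 := M.left_lt
  have hex : ∃ p, k (c - 1) < p ∧ cl p = y :=
    ⟨k c, h.mono _ _ (by omega) (by omega), by rw [hk c (by omega), hy]⟩
  obtain ⟨hq1, hq2⟩ := Nat.find_spec hex
  have hq3 : Nat.find hex ≤ k c := Nat.find_min' hex
    ⟨h.mono _ _ (by omega) (by omega), by rw [hk c (by omega), hy]⟩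
  have hmin := fun p => Nat.find_min hex (m := p)
  set q := Nat.find hex
  have hb := h.left_block M (j := c - 1) (by omega) (by omega)
  refine h.exists_of_class M hcl hk (a := q - (c - s)) (by omega) ?_ fun j hj1 hj2 => ?_
  · rw [show e - 1 = c by omega]; omega
  · rcases eq_or_ne j c with rfl | hjc
    · rw [hy, ← hq2]; congr 1; omega
    · rw [hx j hj1 (by omega)]
      rcases le_or_gt (q - (c - s) + (j - s)) (k (c - 1)) with hp | hp
      · have hi := h.left_block M (j := s + (q - (c - s) + (j - s) - k s)) (by omega) (by omega)
        have h6 := hk (s + (q - (c - s) + (j - s) - k s)) (by omega)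
        rw [hx _ (by omega) (by omega), hi] at h6
        rw [← h6]; congr 1; omega
      · have := hmin (q - (c - s) + (j - s)) (by omega)
        rcases hmid _ hp (by omega) with h7 | h7
        · exact h7
        · exact absurd ⟨hp, h7⟩ this

/-- Mirror image: the window starts at the last position of class `x` before the σ₃ block. -/
theorem exists_of_left_singleton (h : OccursAt u l dP n g k) (M : MergesAt s c e l dP dQ)
    {cl : ℕ → ℕ}
    (hcl : ∀ p q, p < n → q < n → cl p < cl q → g p < g q) (hk : ∀ j, j < l → cl (k j) = u j)
    {x y : ℕ} (hy : ∀ j, c ≤ j → j < e → u j = y) (hs : c = s + 1) (hx : u s = x)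
    (hmid : ∀ p, k s < p → p < k c → cl p = x ∨ cl p = y) :
    ∃ k', OccursAt u l dQ n g k' := by
  classical
  have h3 := M.right_le
  have h4 := M.lt_right
  have hsc := h.mono s c (by omega) (by omega)
  have hle := Nat.findGreatest_le (P := fun p => cl p = x) (k c - 1)
  have hspec := Nat.findGreatest_spec (P := fun p => cl p = x) (m := k s) (n := k c - 1)
    (by omega) (by rw [hk s (by omega), hx])
  have hge := Nat.le_findGreatest (P := fun p => cl p = x) (m := k s) (n := k c - 1)
    (by omega) (by rw [hk s (by omega), hx])
  have hmax := fun p => Nat.findGreatest_is_greatest (P := fun p => cl p = x) (n := k c - 1) (k := p)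
  set q := Nat.findGreatest (fun p => cl p = x) (k c - 1)
  have hb := h.right_block M (j := e - 1) (by omega) (by omega)
  refine h.exists_of_class M hcl hk (a := q) hge (by omega) fun j hj1 hj2 => ?_
  rcases eq_or_ne j s with rfl | hjs
  · simpa [hx] using hspec
  · rw [hy j (by omega) hj2]
    rcases lt_or_ge (q + (j - s)) (k c) with hp | hp
    · have := hmax (q + (j - s)) (by omega) (by omega)
      exact (hmid _ (by omega) hp).resolve_left this
    · have hi := h.right_block M (j := c + (q + (j - s) - k c)) (by omega) (by omega)
      have h6 := hk (c + (q + (j - s) - k c)) (by omega)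
      rw [hy _ (by omega) (by omega), hi] at h6
      rw [← h6]; congr 1; omega

/-- Every position of the two blocks, or between them, is either strictly between them or is
the image of a letter. -/
theorem block_cover (h : OccursAt u l dP n g k) (M : MergesAt s c e l dP dQ) {p : ℕ}
    (h1 : k s ≤ p) (h2 : p ≤ k (e - 1)) :
    (k (c - 1) < p ∧ p < k c) ∨ ∃ j, s ≤ j ∧ j < e ∧ k j = p := by
  have h3 := M.lt_right
  have h4 := M.left_lt
  have hb := h.left_block M (j := c - 1) (by omega) (by omega)
  have hb' := h.right_block M (j := e - 1) (by omega) (by omega)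
  by_cases h5 : p ≤ k (c - 1)
  · right
    refine ⟨s + (p - k s), by omega, by omega, ?_⟩
    rw [h.left_block M (by omega) (by omega)]; omega
  · by_cases h6 : k c ≤ p
    · right
      refine ⟨c + (p - k c), by omega, by omega, ?_⟩
      rw [h.right_block M (by omega) (by omega)]; omega
    · left; omega

/-- With a single 1, the order condition only says that its entry is below all the others. Moving
the 1 to the minimum of the gap, the old entry of the 1 included, keeps this true wherever the other
letters of the window fall. -/
theorem exists_of_unique_min (h : OccursAt u l dP n g k) (M : MergesAt s c e l dP dQ)
    (hg : g.Injective) (hc : u (c - 1) = 1)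
    (hu : ∀ j, j < l → j ≠ c - 1 → u j = 2) : ∃ k', OccursAt u l dQ n g k' := by
  have h3 := M.right_le
  have h4 := M.lt_right
  have h5 := M.left_lt
  have hcc := h.mono (c - 1) c (by omega) (by omega)
  obtain ⟨p, hp, hmin⟩ := Finset.exists_min_image (Finset.Ico (k (c - 1)) (k c)) g
    ⟨k (c - 1), by simp [hcc]⟩
  simp only [Finset.mem_Ico] at hp hmin
  have hb := h.left_block M (j := c - 1) (by omega) (by omega)
  have hb' := h.right_block M (j := e - 1) (by omega) (by omega)
  have hp0 := hmin (k (c - 1)) ⟨le_rfl, hcc⟩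
  have hlt : ∀ j, j < l → j ≠ c - 1 → g p < g (k j) := fun j hj hjc =>
    hp0.trans_lt (h.order j (c - 1) hj (by omega) (by rw [hc, hu j hj hjc]; omega))
  have hwin : ∀ q, k s ≤ q → q ≤ k (e - 1) → q ≠ p → g p < g q := by
    intro q h1 h2 hqp
    refine lt_of_le_of_ne ?_ fun hh => hqp (hg hh).symm
    rcases h.block_cover M h1 h2 with hq | ⟨j, hj1, hj2, rfl⟩
    · exact hmin q ⟨hq.1.le, hq.2⟩
    · rcases eq_or_ne j (c - 1) with rfl | hj
      · exact hp0
      · exact (hlt j (by omega) hj).le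
  refine ⟨fun j => if s ≤ j ∧ j < e then p - (c - 1 - s) + (j - s) else k j,
    h.slide M (a := p - (c - 1 - s)) (by omega) (by omega)
    (fun j h1 h2 => if_pos ⟨h1, h2⟩) (fun j hj => if_neg (by omega)) fun i j hi hj hij => ?_⟩
  have hj' : j = c - 1 := by
    by_contra hne
    rw [hu j hj hne] at hij
    rcases eq_or_ne i (c - 1) with rfl | hi'
    · omega
    · rw [hu i hi hi'] at hij; omega
  have hi' : i ≠ c - 1 := by rintro rfl; rw [hj'] at hij; omega
  rw [if_pos (by omega), show p - (c - 1 - s) + (j - s) = p by omega]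
  split_ifs with hh
  · exact hwin _ (by omega) (by omega) (by omega)
  · exact hlt i hi hi'

/-- Dual argument: the single 2 moves to the maximum of the gap, its old entry included. -/
theorem exists_of_unique_max (h : OccursAt u l dP n g k) (M : MergesAt s c e l dP dQ)
    (hg : g.Injective) (hc : u c = 2)
    (hu : ∀ j, j < l → j ≠ c → u j = 1) : ∃ k', OccursAt u l dQ n g k' := by
  have h3 := M.right_le
  have h4 := M.lt_right
  have h5 := M.left_lt
  have hcc := h.mono (c - 1) c (by omega) (by omega)
  obtain ⟨p, hp, hmax⟩ := Finset.exists_max_image (Finset.Ioc (k (c - 1)) (k c)) g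
    ⟨k c, by simp [hcc]⟩
  simp only [Finset.mem_Ioc] at hp hmax
  have hb := h.left_block M (j := c - 1) (by omega) (by omega)
  have hb' := h.right_block M (j := e - 1) (by omega) (by omega)
  have hp0 := hmax (k c) ⟨hcc, le_rfl⟩
  have hlt : ∀ j, j < l → j ≠ c → g (k j) < g p := fun j hj hjc =>
    (h.order c j (by omega) hj (by rw [hc, hu j hj hjc]; omega)).trans_le hp0
  have hwin : ∀ q, k s ≤ q → q ≤ k (e - 1) → q ≠ p → g q < g p := by
    intro q h1 h2 hqp
    refine lt_of_le_of_ne ?_ fun hh => hqp (hg hh)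
    rcases h.block_cover M h1 h2 with hq | ⟨j, hj1, hj2, rfl⟩
    · exact hmax q ⟨hq.1, hq.2.le⟩
    · rcases eq_or_ne j c with rfl | hj
      · exact hp0
      · exact (hlt j (by omega) hj).le
  refine ⟨fun j => if s ≤ j ∧ j < e then p - (c - s) + (j - s) else k j,
    h.slide M (a := p - (c - s)) (by omega) (by omega)
    (fun j h1 h2 => if_pos ⟨h1, h2⟩) (fun j hj => if_neg (by omega)) fun i j hi hj hij => ?_⟩
  have hi' : i = c := by
    by_contra hne
    rw [hu i hi hne] at hij
    rcases eq_or_ne j c with rfl | hj'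
    · omega
    · rw [hu j hj hj'] at hij; omega
  have hj' : j ≠ c := by rintro rfl; rw [hi'] at hij; omega
  rw [if_pos (show s ≤ i ∧ i < e by omega), show p - (c - s) + (i - s) = p by omega]
  split_ifs with hh
  · exact hwin _ (by omega) (by omega) (by omega)
  · exact hlt j hj hj'

/-- An occurrence of a pattern of length `l` in a sequence of length `l + 1` misses exactly one
position. -/
theorem exists_missed (h : OccursAt u l d (l + 1) g k) :
    ∃ D, ∀ j, j < l → k j = if j < D then j else j + 1 := by
  classical
  have hup : ∀ j, j < l → k j ≤ j + 1 := fun j hj => by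
    have := h.add_sub_le (i := j) (j := l - 1) (by omega) (by omega)
    have := h.lt (l - 1) (by omega)
    omega
  -- `D` is the first displaced letter, or `l` if there is none; the spare room of one position is
  -- then used up.
  have hex : ∃ j, j = l ∨ k j ≠ j := ⟨l, Or.inl rfl⟩
  have hspec := Nat.find_spec hex
  have hmin := fun p => Nat.find_min hex (m := p)
  refine ⟨Nat.find hex, fun j hj => ?_⟩
  set D := Nat.find hex
  split_ifs with hjD
  · have := hmin j hjD
    tauto
  · have h0 := h.add_sub_le (i := 0) (j := D) (by omega) (by omega)
    have h1 := h.add_sub_le (i := D) (j := j) (by omega) hj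
    have := hup j hj
    rcases hspec with h2 | h2 <;> omega

end OccursAt

/-! ### Necessity: inserting entries between the two blocks -/

/-- The sequence `y` arises from `v` by moving the entries in `[c, D - 1)` one place to the right
and putting `X` at `c`. -/
structure ShiftsRight (l c e : ℕ) (v y : ℕ → ℕ) (X D : ℕ) : Prop where
  le : e ≤ D
  new : y c = X
  fixed : ∀ j, j < c ∨ D ≤ j → j < l → y j = v j
  moved : ∀ j, c < j → j < D → j < l → y j = v (j - 1)

/-- The sequence `y` arises from `v` by moving the entries in `[D + 1, c)` one place to the left
and putting `X` at `c - 1`. -/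
structure ShiftsLeft (l s c : ℕ) (v y : ℕ → ℕ) (X D : ℕ) : Prop where
  le : D ≤ s
  new : y (c - 1) = X
  fixed : ∀ j, j < D ∨ c ≤ j → j < l → y j = v j
  moved : ∀ j, D ≤ j → j + 1 < c → y j = v (j + 1)

/-- Every sequence containing the pattern with dashes `dP` has a refinement containing the pattern
with dashes `dQ`. -/
def Forces (u : ℕ → ℕ) (l : ℕ) (dP dQ : ℕ → Prop) : Prop :=
  ∀ n f k, OccursAt u l dP n f k → ∃ g k' : ℕ → ℕ,
    (∀ p q, p < n → q < n → f p < f q → g p < g q) ∧ OccursAt u l dQ n g k'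

section

variable {u : ℕ → ℕ} {l : ℕ} {dP dQ : ℕ → Prop} {s c e m : ℕ}

/-- The factor 4 leaves room for `δ` to break ties inside a letter and for `x` to fall strictly
between any two of the resulting levels 0 and 2. Here `v` lists the values of the original entries,
`X` is that of the inserted one, and `y` lists the values used by the occurrence of `Q`. -/
theorem Forces.insert (H : Forces u l dP dQ) (M : MergesAt s c e l dP dQ) (δ : ℕ → ℕ)
    (hδ : ∀ j, δ j ≤ 2) (x : ℕ) :
    ∃ (v y : ℕ → ℕ) (X D : ℕ),
      (∀ i j, i < l → j < l → 4 * u i + δ i < 4 * u j + δ j → v i < v j) ∧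
      (∀ i, i < l → 4 * u i + δ i < x → v i < X) ∧
      (∀ i, i < l → x < 4 * u i + δ i → X < v i) ∧
      (∀ i j, i < l → j < l → u j < u i → y j < y i) ∧
      (ShiftsRight l c e v y X D ∨ ShiftsLeft l s c v y X D) := by
  have h1 := M.left_lt
  have h2 := M.lt_right
  have h3 := M.right_le
  obtain ⟨w, hw⟩ : ∃ w : ℕ → ℕ, ∀ r, w r = 4 * u r + δ r := ⟨_, fun _ => rfl⟩
  obtain ⟨f, hf⟩ : ∃ f : ℕ → ℕ, ∀ p, f p = if p = c then x else w (if p < c then p else p - 1) :=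
    ⟨_, fun _ => rfl⟩
  have hfc : f c = x := by simp [hf]
  have hfE : ∀ r, f (if r < c then r else r + 1) = w r := by
    intro r
    rw [hf]
    split_ifs <;> first | omega | rfl
  obtain ⟨g, k', hg, hk'⟩ := H (l + 1) f (fun j => if j < c then j else j + 1)
    ⟨fun i j hij hj => by split_ifs <;> omega,
      fun i hi => by split_ifs <;> omega,
      fun i j hi hj hij => by
        rw [hfE, hfE, hw, hw]
        have := hδ j
        omega,
      fun i hi hd => by
        have : i + 1 ≠ c := fun h => hd ((M.dash_iff _).2 (Or.inl h))
        split_ifs <;> omega⟩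
  have hlt : ∀ r, r < l → (if r < c then r else r + 1) < l + 1 := fun r hr => by
    split_ifs <;> omega
  obtain ⟨D, hD⟩ := hk'.exists_missed
  refine ⟨fun r => g (if r < c then r else r + 1), fun j => g (k' j), g c, D,
    fun i j hi hj hij => hg _ _ (hlt i hi) (hlt j hj) ?_,
    fun i hi hx => hg _ _ (hlt i hi) (by omega) ?_,
    fun i hi hx => hg _ _ (by omega) (hlt i hi) ?_,
    hk'.order, ?_⟩
  · rw [hfE, hfE, hw, hw]; exact hij
  · rw [hfE, hfc, hw]; exact hx
  · rw [hfE, hfc, hw]; exact hx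
  -- A missed position inside the merged block would break its adjacency.
  · have hDs : D ≤ s ∨ e ≤ D := by
      by_contra! hcon
      have := hk'.adjacent (D - 1) (by omega)
        (by rw [show D - 1 + 1 = D by omega]; exact M.no_dash D hcon.1 hcon.2)
      rw [show D - 1 + 1 = D by omega, hD D (by omega), hD (D - 1) (by omega), if_neg (by omega),
        if_pos (by omega)] at this
      omega
    rcases hDs with hDs | hDs
    · right
      refine ⟨hDs, ?_, fun j hj hjl => ?_, fun j hj hjc => ?_⟩
      · rw [hD _ (by omega), if_neg (by omega)]; congr 1; omega
      · rw [hD _ hjl]; congr 1; split_ifs <;> omega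
      · rw [hD _ (by omega)]; congr 1; split_ifs <;> omega
    · left
      refine ⟨hDs, ?_, fun j hj hjl => ?_, fun j hj hjc hjl => ?_⟩
      · rw [hD _ (by omega), if_pos (by omega)]
      · rw [hD _ hjl]; congr 1; split_ifs <;> omega
      · rw [hD _ hjl]; congr 1; split_ifs <;> omega

/-- If both blocks have at least two letters, equal in each of them, then inserting a large and a
small entry between the blocks avoids the merged pattern. -/
theorem Forces.singleton_of_constant (H : Forces u l dP dQ) (M : MergesAt s c e l dP dQ)
    (hu : ∀ j, j < l → 1 ≤ u j ∧ u j ≤ m) (hm : 2 ≤ m)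
    (h1 : ∀ j, s ≤ j → j < c → u j = 1) (h2 : ∀ j, c ≤ j → j < e → u j = m) :
    c = s + 1 ∨ e = c + 1 := by
  by_contra! hcon
  have h3 := M.left_lt
  have h4 := M.lt_right
  have h5 := M.right_le
  obtain ⟨f, hf⟩ : ∃ f : ℕ → ℕ, ∀ p, f p = if p = c then m + 1 else if p = c + 1 then 0 else
    u (if p < c then p else p - 2) := ⟨_, fun _ => rfl⟩
  have hfE : ∀ r, f (if r < c then r else r + 2) = u r := by
    intro r
    rw [hf]
    split_ifs <;> first | omega | rfl
  have hf1 : ∀ p, p < l + 2 → p ≠ c → f p < f c := by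
    intro p hp hpc
    rw [hf c, if_pos rfl, hf, if_neg hpc]
    split_ifs
    · omega
    · have := hu p (by omega); omega
    · have := hu (p - 2) (by omega); omega
  have hf2 : ∀ p, p < l + 2 → p ≠ c + 1 → f (c + 1) < f p := by
    intro p hp hpc
    rw [hf (c + 1), if_neg (by omega), if_pos rfl, hf, if_neg hpc]
    split_ifs
    · omega
    · have := hu p (by omega); omega
    · have := hu (p - 2) (by omega); omega
  obtain ⟨g, k, hg, hk⟩ := H (l + 2) f (fun j => if j < c then j else j + 2)
    ⟨fun i j hij hj => by split_ifs <;> omega,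
      fun i hi => by split_ifs <;> omega,
      fun i j hi hj hij => by
        rwa [hfE, hfE],
      fun i hi hd => by
        have : i + 1 ≠ c := fun h => hd ((M.dash_iff _).2 (Or.inl h))
        split_ifs <;> omega⟩
  have hwin : ∀ j, s ≤ j → j < e → k j = k s + (j - s) := fun j hj hje =>
    hk.eq_add_of_no_dash h5 M.no_dash hj hje
  have hks := hk.add_sub_le (i := 0) (j := s) (by omega) (by omega)
  have hke := hk.add_sub_le (i := s) (j := l - 1) (by omega) (by omega)
  have hkl := hk.lt (l - 1) (by omega)
  -- The large entry cannot play a letter of σ₂, nor the small one a letter of σ₃.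
  have hlow : ∀ j, s ≤ j → j < c → k j ≠ c := by
    intro j hj hjc hkj
    have := hk.order c j (by omega) (by omega) (by rw [h1 j hj hjc, h2 c le_rfl h4]; omega)
    have := hk.mono j c hjc (by omega)
    have := hg (k c) c (hk.lt c (by omega)) (by omega)
      (hf1 _ (hk.lt c (by omega)) (by omega))
    rw [hkj] at *
    omega
  have hhigh : ∀ j, c ≤ j → j < e → k j ≠ c + 1 := by
    intro j hj hjc hkj
    have := hk.order j (c - 1) (by omega) (by omega)
      (by rw [h1 (c - 1) (by omega) (by omega), h2 j hj hjc]; omega)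
    have := hk.mono (c - 1) j (by omega) (by omega)
    have := hg (c + 1) (k (c - 1)) (by omega) (hk.lt _ (by omega))
      (hf2 _ (hk.lt _ (by omega)) (by omega))
    rw [hkj] at *
    omega
  -- Only two positions are missed, so the block is shifted by at most 2; as both blocks have two
  -- letters, each shift puts a letter on a forbidden entry.
  have hks' : k s = s ∨ k s = s + 1 ∨ k s = s + 2 := by omega
  rcases hks' with hh | hh | hh
  · exact hhigh (c + 1) (by omega) (by omega) (by rw [hwin _ (by omega) (by omega)]; omega)
  · exact hlow (c - 1) (by omega) (by omega) (by rw [hwin _ (by omega) (by omega)]; omega)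
  · exact hlow (c - 2) (by omega) (by omega) (by rw [hwin _ (by omega) (by omega)]; omega)

namespace ShiftsRight

variable {v y : ℕ → ℕ} {X D : ℕ}

/-- If the letter after an `m` were smaller, it would be played by the old entry of that `m`, which
exceeds `X`, although `X` itself plays an `m`. -/
theorem eq_max (S : ShiftsRight l c e v y X D)
    (hy : ∀ i j, i < l → j < l → u j < u i → y j < y i) (hu : ∀ j, j < l → u j ≤ m)
    (hc : u c = m) (hcl : c < l) (hX : ∀ i, i < l → u i = m → X < v i) :
    ∀ j, c ≤ j → j < D → j < l → u j = m := by
  intro j hj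
  induction j, hj using Nat.le_induction with
  | base => exact fun _ _ => hc
  | succ j hj ih =>
    intro hjD hjl
    have h1 := ih (by omega) (by omega)
    by_contra hne
    have h2 := hy c (j + 1) hcl hjl (by have := hu (j + 1) hjl; omega)
    rw [S.new, S.moved _ (by omega) hjD hjl, Nat.add_sub_cancel] at h2
    have := hX j (by omega) h1
    omega

/-- By `eq_max` a smaller letter is not in the shifted range, so it keeps its entry, which must lie
below `X`. -/
theorem lt_new (S : ShiftsRight l c e v y X D)
    (hy : ∀ i j, i < l → j < l → u j < u i → y j < y i) (hu : ∀ j, j < l → u j ≤ m)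
    (hc : u c = m) (hcl : c < l) (hX : ∀ i, i < l → u i = m → X < v i) {i : ℕ} (hi : i < l)
    (hui : u i < m) : v i < X := by
  have h1 := S.eq_max hy hu hc hcl hX i
  have h2 := hy c i hcl hi (by omega)
  rwa [S.new, S.fixed i (by omega) hi] at h2

end ShiftsRight

namespace ShiftsLeft

variable {v y : ℕ → ℕ} {X D : ℕ}

theorem eq_one (S : ShiftsLeft l s c v y X D)
    (hy : ∀ i j, i < l → j < l → u j < u i → y j < y i) (hu : ∀ j, j < l → 1 ≤ u j)
    (hc : u (c - 1) = 1) (hcl : c < l) (hX : ∀ i, i < l → u i = 1 → v i < X) :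
    ∀ j, j < c → D ≤ j → u j = 1 := by
  -- Downward induction, with `t` the distance from `c - 1`.
  suffices ∀ t j, j + 1 + t = c → D ≤ j → u j = 1 from
    fun j hj hD => this (c - 1 - j) j (by omega) hD
  intro t
  induction t with
  | zero => intro j hj _; rwa [show j = c - 1 by omega]
  | succ t ih =>
    intro j hj hD
    have h1 := ih (j + 1) (by omega) (by omega)
    by_contra hne
    have h2 := hy j (c - 1) (by omega) (by omega) (by have := hu j (by omega); omega)
    rw [S.new, S.moved _ hD (by omega)] at h2
    have := hX (j + 1) (by omega) h1
    omega

theorem new_lt (S : ShiftsLeft l s c v y X D)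
    (hy : ∀ i j, i < l → j < l → u j < u i → y j < y i) (hu : ∀ j, j < l → 1 ≤ u j)
    (hc : u (c - 1) = 1) (hcl : c < l) (hX : ∀ i, i < l → u i = 1 → v i < X) {i : ℕ}
    (hi : i < l) (hui : 1 < u i) : X < v i := by
  have h1 := S.eq_one hy hu hc hcl hX i
  have h2 := hy i (c - 1) hi (by omega) (by omega)
  rwa [S.new, S.fixed i (by omega) hi] at h2

end ShiftsLeft

/-- Insert a value below everything. It plays the letter at `c` or at `c - 1`; were both larger than
1, any letter 1 would need an even smaller entry. -/
theorem Forces.left_last (H : Forces u l dP dQ) (M : MergesAt s c e l dP dQ)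
    (hu : ∀ j, j < l → 1 ≤ u j ∧ u j ≤ m) (h1 : ∃ j, j < l ∧ u j = 1)
    (hle : u (c - 1) ≤ u c) : u (c - 1) = 1 := by
  by_contra hne
  have h3 := M.left_lt
  have h4 := M.lt_right
  have h5 := M.right_le
  obtain ⟨v, y, X, D, -, -, hX, hy, hS⟩ := H.insert M (fun _ => 0) (by simp) 0
  obtain ⟨r, hr, hr1⟩ := h1
  have hX' : ∀ i, i < l → X < v i := fun i hi => hX i hi (by have := hu i hi; simp; omega)
  have huc := hu (c - 1) (by omega)
  rcases hS with S | S
  · have h6 := hy c r (by omega) hr (by omega)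
    have hrc : r ≠ c := by rintro rfl; omega
    rw [S.new] at h6
    by_cases hD : r < c ∨ D ≤ r
    · rw [S.fixed r hD hr] at h6; have := hX' r hr; omega
    · rw [S.moved r (by omega) (by omega) hr] at h6; have := hX' (r - 1) (by omega); omega
  · have h6 := hy (c - 1) r (by omega) hr (by omega)
    have hrc : r ≠ c - 1 := by rintro rfl; omega
    rw [S.new] at h6
    by_cases hD : r < D ∨ c ≤ r
    · rw [S.fixed r hD hr] at h6; have := hX' r hr; omega
    · rw [S.moved r (by omega) (by omega)] at h6; have := hX' (r + 1) (by omega); omega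

/-- Dual argument with a value above everything. -/
theorem Forces.right_first (H : Forces u l dP dQ) (M : MergesAt s c e l dP dQ)
    (hu : ∀ j, j < l → 1 ≤ u j ∧ u j ≤ m) (h1 : ∃ j, j < l ∧ u j = m)
    (hle : u (c - 1) ≤ u c) : u c = m := by
  by_contra hne
  have h3 := M.left_lt
  have h4 := M.lt_right
  have h5 := M.right_le
  obtain ⟨v, y, X, D, -, hX, -, hy, hS⟩ := H.insert M (fun _ => 0) (by simp) (4 * m + 1)
  obtain ⟨r, hr, hr1⟩ := h1
  have hX' : ∀ i, i < l → v i < X := fun i hi => hX i hi (by have := hu i hi; simp; omega)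
  have huc := hu c (by omega)
  rcases hS with S | S
  · have h6 := hy r c hr (by omega) (by omega)
    have hrc : r ≠ c := by rintro rfl; omega
    rw [S.new] at h6
    by_cases hD : r < c ∨ D ≤ r
    · rw [S.fixed r hD hr] at h6; have := hX' r hr; omega
    · rw [S.moved r (by omega) (by omega) hr] at h6; have := hX' (r - 1) (by omega); omega
  · have h6 := hy r (c - 1) hr (by omega) (by omega)
    have hrc : r ≠ c - 1 := by rintro rfl; omega
    rw [S.new] at h6
    by_cases hD : r < D ∨ c ≤ r
    · rw [S.fixed r hD hr] at h6; have := hX' r hr; omega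
    · rw [S.moved r (by omega) (by omega)] at h6; have := hX' (r + 1) (by omega); omega

/-- Two entries of intermediate letters can be separated by the inserted entry. -/
theorem Forces.intermediate_unique (H : Forces u l dP dQ) (M : MergesAt s c e l dP dQ)
    (hu : ∀ j, j < l → 1 ≤ u j ∧ u j ≤ m) (h1 : u (c - 1) = 1) (h2 : u c = m)
    {i j : ℕ} (hi : i < l) (hj : j < l) (hi1 : 1 < u i) (him : u i < m) (hj1 : 1 < u j)
    (hjm : u j < m) : i = j := by
  wlog hij : u i ≤ u j generalizing i j
  · exact (this hj hi hj1 hjm hi1 him (by omega)).symm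
  by_contra hne
  have h3 := M.left_lt
  have h4 := M.lt_right
  have h5 := M.right_le
  obtain ⟨v, y, X, D, -, hXl, hXg, hy, hS⟩ := H.insert M (fun r => if r = j then 2 else 0)
    (fun r => by split_ifs <;> omega) (4 * u i + 1)
  -- Even if `u i = u j`, the inserted value lies above the entry of `i` and below that of `j`. As
  -- an `m` it would have to exceed the latter, as a 1 to be below the former.
  have hi' := hXl i hi (by simp [hne])
  have hj' := hXg j hj (by simp; omega)
  rcases hS with S | S
  · have := S.lt_new hy (fun r hr => (hu r hr).2) h2 (by omega)
      (fun r hr hrm => hXg r hr (by omega)) hj hjm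
    omega
  · have := S.new_lt hy (fun r hr => (hu r hr).1) h1 (by omega)
      (fun r hr hrm => hXl r hr (by split_ifs <;> [(subst r; omega); omega])) hi hi1
    omega

theorem Forces.right_constant_of_intermediate (H : Forces u l dP dQ) (M : MergesAt s c e l dP dQ)
    (hu : ∀ j, j < l → 1 ≤ u j ∧ u j ≤ m) (h1 : u (c - 1) = 1) (h2 : u c = m)
    {i : ℕ} (hi : i < l) (hi1 : 1 < u i) (him : u i < m) : ∀ j, c ≤ j → j < e → u j = m := by
  have h3 := M.left_lt
  have h4 := M.lt_right
  have h5 := M.right_le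
  -- A value just above the entry of `i` cannot play a 1, so it plays the first letter of σ₃, and
  -- `eq_max` covers that whole block.
  obtain ⟨v, y, X, D, -, hXl, hXg, hy, hS⟩ := H.insert M (fun _ => 0) (by simp) (4 * u i + 1)
  have hi' := hXl i hi (by simp)
  rcases hS with S | S
  · have hD := S.le
    exact fun j hj hje => S.eq_max hy (fun r hr => (hu r hr).2) h2 (by omega)
      (fun r hr hrm => hXg r hr (by omega)) j hj (by omega) (by omega)
  · have := S.new_lt hy (fun r hr => (hu r hr).1) h1 (by omega)
      (fun r hr hrm => hXl r hr (by omega)) hi hi1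
    omega

theorem Forces.left_constant_of_intermediate (H : Forces u l dP dQ) (M : MergesAt s c e l dP dQ)
    (hu : ∀ j, j < l → 1 ≤ u j ∧ u j ≤ m) (h1 : u (c - 1) = 1) (h2 : u c = m)
    {i : ℕ} (hi : i < l) (hi1 : 1 < u i) (him : u i < m) : ∀ j, s ≤ j → j < c → u j = 1 := by
  have h3 := M.left_lt
  have h4 := M.lt_right
  have h5 := M.right_le
  -- A value just below the entry of `i` cannot play an `m`, so the shift is to the left.
  obtain ⟨v, y, X, D, -, hXl, hXg, hy, hS⟩ := H.insert M (fun _ => 0) (by simp) (4 * u i - 1)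
  have hi' := hXg i hi (by omega)
  rcases hS with S | S
  · have := S.lt_new hy (fun r hr => (hu r hr).2) h2 (by omega)
      (fun r hr hrm => hXg r hr (by omega)) hi him
    omega
  · have hD := S.le
    exact fun j hj hje => S.eq_one hy (fun r hr => (hu r hr).1) h1 (by omega)
      (fun r hr hrm => hXl r hr (by omega)) j hje (by omega)

theorem Forces.two_unique (H : Forces u l dP dQ) (M : MergesAt s c e l dP dQ)
    (hu : ∀ j, j < l → u j = 1 ∨ u j = 2) (h1 : u (c - 1) = 1) (h2 : u c = 2)
    (hne : ¬ ∀ j, c ≤ j → j < e → u j = 2) {q : ℕ} (hq : q < l) (hq2 : u q = 2) : q = c := by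
  by_contra hqc
  have h3 := M.left_lt
  have h4 := M.lt_right
  have h5 := M.right_le
  have he : c + 1 < e := by
    by_contra hcon
    exact hne fun j hj hje => by rwa [show j = c by omega]
  -- The value 11 exceeds all weights, so it must play a 2. The letter at `c + 1` is then played by
  -- the old entry of `c`. That entry is made the least of the 2s if it again plays a 2; if it is to
  -- play a 1, the entry of `q` is put below it instead.
  obtain ⟨v, y, X, D, hv, hX, -, hy, hS⟩ := H.insert M
    (fun r => if r = (if u (c + 1) = 2 then c else q) then 0 else 2)
    (fun r => by split_ifs <;> omega) 11
  have hX' : ∀ i, i < l → v i < X := fun i hi =>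
    hX i hi (by have := hu i hi; split_ifs <;> omega)
  rcases hS with S | S
  · have hD := S.le
    rcases hu (c + 1) (by omega) with h6 | h6
    · have h7 : ∀ j, c + 1 ≤ j → j < D → j < l → u j = 1 := by
        intro j hj
        induction j, hj using Nat.le_induction with
        | base => exact fun _ _ => h6
        | succ j hj ih =>
          intro hjD hjl
          have h8 := ih (by omega) (by omega)
          by_contra hcon
          have h9 := hu (j + 1) hjl
          have h10 := hy (j + 1) (c + 1) hjl (by omega) (by omega)
          rw [S.moved _ (by omega) hjD hjl, S.moved _ (by omega) (by omega) (by omega)] at h10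
          have := hv j c (by omega) (by omega) (by
            rw [h8, h2]
            split_ifs <;> omega)
          simp only [Nat.add_sub_cancel] at h10
          omega
      have h8 := h7 q
      have h9 := hy q (c + 1) hq (by omega) (by omega)
      rw [S.fixed q (by omega) hq, S.moved _ (by omega) (by omega) (by omega),
        Nat.add_sub_cancel] at h9
      have := hv q c hq (by omega) (by
        rw [if_neg (show u (c + 1) ≠ 2 by omega), if_pos rfl, if_neg (by omega)]
        omega)
      omega
    · refine hne fun j hj hje => ?_
      induction j, hj using Nat.le_induction with
      | base => exact h2
      | succ j hj ih =>
        have h8 := ih (by omega)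
        rcases eq_or_ne j c with rfl | hjc
        · exact h6
        by_contra hcon
        have h9 := hu (j + 1) (by omega)
        have h10 := hy (c + 1) (j + 1) (by omega) (by omega) (by omega)
        rw [S.moved _ (by omega) (by omega) (by omega),
          S.moved _ (by omega) (by omega) (by omega)] at h10
        have := hv c j (by omega) (by omega) (by
          rw [if_pos h6, if_pos rfl, if_neg hjc]
          omega)
        simp only [Nat.add_sub_cancel] at h10
        omega
  · have h6 := hy c (c - 1) (by omega) (by omega) (by omega)
    rw [S.new, S.fixed c (by omega) (by omega)] at h6
    have := hX' c (by omega)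
    omega

/-- Reverse-complement of `two_unique`: the inserted value is below everything, and `δ` singles out
the largest 1 instead of the smallest 2. -/
theorem Forces.one_unique (H : Forces u l dP dQ) (M : MergesAt s c e l dP dQ)
    (hu : ∀ j, j < l → u j = 1 ∨ u j = 2) (h1 : u (c - 1) = 1) (h2 : u c = 2)
    (hne : ¬ ∀ j, s ≤ j → j < c → u j = 1) {q : ℕ} (hq : q < l) (hq1 : u q = 1) : q = c - 1 := by
  by_contra hqc
  have h3 := M.left_lt
  have h4 := M.lt_right
  have h5 := M.right_le
  have he : s + 1 < c := by
    by_contra hcon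
    exact hne fun j hj hje => by rwa [show j = c - 1 by omega]
  obtain ⟨v, y, X, D, hv, -, hX, hy, hS⟩ := H.insert M
    (fun r => if r = (if u (c - 2) = 1 then c - 1 else q) then 2 else 0)
    (fun r => by split_ifs <;> omega) 0
  have hX' : ∀ i, i < l → X < v i := fun i hi =>
    hX i hi (by have := hu i hi; split_ifs <;> omega)
  rcases hS with S | S
  · have h6 := hy c (c - 1) (by omega) (by omega) (by omega)
    rw [S.new, S.fixed (c - 1) (by omega) (by omega)] at h6
    have := hX' (c - 1) (by omega)
    omega
  · have hD := S.le
    have hm2 := S.moved (c - 2) (by omega) (by omega)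
    rw [show c - 2 + 1 = c - 1 by omega] at hm2
    rcases hu (c - 2) (by omega) with h6 | h6
    · have h7 : ∀ t j, j + 1 + t = c → D ≤ j → u j = 1 := by
        intro t
        induction t with
        | zero => intro j hj _; rwa [show j = c - 1 by omega]
        | succ t ih =>
          intro j hj hjD
          have h8 := ih (j + 1) (by omega) (by omega)
          rcases eq_or_ne j (c - 2) with rfl | hjc
          · exact h6
          by_contra hcon
          have h9 := hu j (by omega)
          have h10 := hy j (c - 2) (by omega) (by omega) (by omega)
          rw [S.moved j hjD (by omega), hm2] at h10
          have := hv (j + 1) (c - 1) (by omega) (by omega) (by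
            rw [if_pos h6, if_pos rfl, if_neg (by omega)]
            omega)
          omega
      exact hne fun j hj hjc => h7 (c - 1 - j) j (by omega) (by omega)
    · have h7 : ∀ t j, j + 2 + t = c → D ≤ j → u j = 2 := by
        intro t
        induction t with
        | zero => intro j hj _; rwa [show j = c - 2 by omega]
        | succ t ih =>
          intro j hj hjD
          have h8 := ih (j + 1) (by omega) (by omega)
          by_contra hcon
          have h9 := hu j (by omega)
          have h10 := hy (c - 2) j (by omega) (by omega) (by omega)
          rw [S.moved j hjD (by omega), hm2] at h10
          have := hv (c - 1) (j + 1) (by omega) (by omega) (by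
            rw [h8, h1]
            split_ifs <;> omega)
          omega
      have h8 := h7 (c - 2 - q) q
      have h9 := hy (c - 2) q (by omega) hq (by omega)
      rw [S.fixed q (by omega) hq, hm2] at h9
      have := hv (c - 1) q (by omega) hq (by
        rw [if_neg (show u (c - 2) ≠ 1 by omega), if_pos rfl, if_neg (by omega)]
        omega)
      omega

end

/-! ### Value classes and the six shapes -/

section

variable {u : ℕ → ℕ} {l n : ℕ} {d dP dQ : ℕ → Prop} {g k : ℕ → ℕ} {s c e m : ℕ}

theorem OccursAt.exists_class_two (h : OccursAt u l d n g k)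
    (hu : ∀ j, j < l → u j = 1 ∨ u j = 2) :
    ∃ cl : ℕ → ℕ, (∀ p q, p < n → q < n → cl p < cl q → g p < g q) ∧
      (∀ j, j < l → cl (k j) = u j) ∧ ∀ p, cl p = 1 ∨ cl p = 2 := by
  classical
  -- The threshold is the largest entry playing a 1.
  refine ⟨fun p => if ∃ i, i < l ∧ u i = 1 ∧ g p ≤ g (k i) then 1 else 2,
    fun p q _ _ hpq => ?_, fun j hj => ?_, fun p => ?_⟩
  · by_cases hp : ∃ i, i < l ∧ u i = 1 ∧ g p ≤ g (k i)
    · by_cases hq : ∃ i, i < l ∧ u i = 1 ∧ g q ≤ g (k i)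
      · simp [hp, hq] at hpq
      · obtain ⟨i, hi, hi1, hpi⟩ := hp
        by_contra hcon
        exact hq ⟨i, hi, hi1, by omega⟩
    · by_cases hq : ∃ i, i < l ∧ u i = 1 ∧ g q ≤ g (k i) <;> simp [hp, hq] at hpq
  · beta_reduce
    rcases hu j hj with hj1 | hj2
    · rw [if_pos ⟨j, hj, hj1, le_rfl⟩, hj1]
    · rw [if_neg, hj2]
      rintro ⟨i, hi, hi1, hle⟩
      have := h.order j i hj hi (by omega)
      omega
  · by_cases hp : ∃ i, i < l ∧ u i = 1 ∧ g p ≤ g (k i) <;> simp [hp]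

/-- The entry of the only 2 serves as threshold, and by injectivity no other position has class 2.
-/
theorem OccursAt.exists_class_three (h : OccursAt u l d n g k) (hg : g.Injective)
    (hu : ∀ j, j < l → u j = 1 ∨ u j = 2 ∨ u j = 3) {t : ℕ} (ht : t < l) (ht2 : u t = 2)
    (huniq : ∀ j, j < l → u j = 2 → j = t) :
    ∃ cl : ℕ → ℕ, (∀ p q, p < n → q < n → cl p < cl q → g p < g q) ∧
      (∀ j, j < l → cl (k j) = u j) ∧ ∀ p, p ≠ k t → cl p = 1 ∨ cl p = 3 := by
  refine ⟨fun p => if g p < g (k t) then 1 else if g p = g (k t) then 2 else 3,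
    fun p q _ _ hpq => ?_, fun j hj => ?_, fun p hp => ?_⟩
  · beta_reduce at hpq
    split_ifs at hpq <;> omega
  · beta_reduce
    rcases hu j hj with h1 | h2 | h3
    · rw [if_pos (h.order t j ht hj (by omega)), h1]
    · simp [huniq j hj h2, ht2]
    · have := h.order j t hj ht (by omega)
      rw [if_neg (by omega), if_neg (by omega), h3]
  · have := hg.ne hp
    beta_reduce
    split_ifs <;> simp_all

/-- The letterwise form of the six properties. -/
def HasSlidingShape (u : ℕ → ℕ) (s c e l : ℕ) : Prop :=
  ((∀ j, s ≤ j → j < c → u j = 1) ∧ e = c + 1 ∧ u c = 2 ∧ ∀ j, j < l → u j = 1 ∨ u j = 2) ∨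
  (c = s + 1 ∧ u s = 1 ∧ (∀ j, c ≤ j → j < e → u j = 2) ∧ ∀ j, j < l → u j = 1 ∨ u j = 2) ∨
  (s + 1 < c ∧ u (c - 1) = 1 ∧ ∀ j, j < l → j ≠ c - 1 → u j = 2) ∨
  (c + 1 < e ∧ u c = 2 ∧ ∀ j, j < l → j ≠ c → u j = 1) ∨
  ((∀ j, s ≤ j → j < c → u j = 1) ∧ e = c + 1 ∧ u c = 3 ∧
    (∀ j, j < l → u j = 1 ∨ u j = 2 ∨ u j = 3) ∧
    ∃ t, t < l ∧ u t = 2 ∧ ∀ j, j < l → u j = 2 → j = t) ∨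
  (c = s + 1 ∧ u s = 1 ∧ (∀ j, c ≤ j → j < e → u j = 3) ∧
    (∀ j, j < l → u j = 1 ∨ u j = 2 ∨ u j = 3) ∧
    ∃ t, t < l ∧ u t = 2 ∧ ∀ j, j < l → u j = 2 → j = t)

theorem HasSlidingShape.exists_occursAt (S : HasSlidingShape u s c e l)
    (M : MergesAt s c e l dP dQ) (hg : g.Injective) (h : OccursAt u l dP n g k) :
    ∃ k', OccursAt u l dQ n g k' := by
  have h3 := M.left_lt
  have h4 := M.lt_right
  have h5 := M.right_le
  -- No letter of the occurrence lies strictly between the blocks; in particular the unique 2 of (5)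
  -- and (6) does not.
  have hbetween : ∀ t, t < l → ∀ p, k (c - 1) < p → p < k c → p ≠ k t := by
    rintro t ht _ h1 h2 rfl
    rcases lt_trichotomy t (c - 1) with h6 | h6 | h6
    · have := h.mono t (c - 1) h6 (by omega); omega
    · subst h6; omega
    · rcases eq_or_ne t c with rfl | h7
      · omega
      · have := h.mono c t (by omega) ht; omega
  rcases S with ⟨h1, h2, h6, h7⟩ | ⟨h1, h2, h6, h7⟩ | ⟨-, h1, h2⟩ | ⟨-, h1, h2⟩ |
    ⟨h1, h2, h6, h7, t, ht, ht2, hu⟩ | ⟨h1, h2, h6, h7, t, ht, ht2, hu⟩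
  · obtain ⟨cl, hcl, hk, hcl'⟩ := h.exists_class_two h7
    exact h.exists_of_right_singleton M hcl hk h1 h2 h6 fun p _ _ => hcl' p
  · obtain ⟨cl, hcl, hk, hcl'⟩ := h.exists_class_two h7
    exact h.exists_of_left_singleton M hcl hk h6 h1 h2 fun p _ _ => hcl' p
  · exact h.exists_of_unique_min M hg h1 h2
  · exact h.exists_of_unique_max M hg h1 h2
  · obtain ⟨cl, hcl, hk, hcl'⟩ := h.exists_class_three hg h7 ht ht2 hu
    exact h.exists_of_right_singleton M hcl hk h1 h2 h6
      fun p hp hp' => hcl' p (hbetween t ht p hp hp')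
  · obtain ⟨cl, hcl, hk, hcl'⟩ := h.exists_class_three hg h7 ht ht2 hu
    exact h.exists_of_left_singleton M hcl hk h6 h1 h2
      fun p hp hp' => hcl' p (hbetween t ht p (by rwa [h1, Nat.add_sub_cancel]) hp')

theorem Forces.hasSlidingShape (H : Forces u l dP dQ) (M : MergesAt s c e l dP dQ)
    (hu : ∀ j, j < l → 1 ≤ u j ∧ u j ≤ m) (hall : ∀ a, 1 ≤ a → a ≤ m → ∃ j, j < l ∧ u j = a)
    (hm : 2 ≤ m) (hle : u (c - 1) ≤ u c) : HasSlidingShape u s c e l := by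
  have h3 := M.left_lt
  have h4 := M.lt_right
  have h5 := M.right_le
  have h1 := H.left_last M hu (hall 1 (by omega) (by omega)) hle
  have h2 := H.right_first M hu (hall m (by omega) (by omega)) hle
  rcases (show m = 2 ∨ 3 ≤ m by omega) with rfl | hm3
  · have hu' : ∀ j, j < l → u j = 1 ∨ u j = 2 := fun j hj => by have := hu j hj; omega
    by_cases hl : ∀ j, s ≤ j → j < c → u j = 1
    · by_cases hr : ∀ j, c ≤ j → j < e → u j = 2
      · rcases H.singleton_of_constant M hu hm hl hr with hc | hc
        · exact Or.inr (Or.inl ⟨hc, hl s le_rfl h3, hr, hu'⟩)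
        · exact Or.inl ⟨hl, hc, h2, hu'⟩
      · refine Or.inr (Or.inr (Or.inr (Or.inl ⟨?_, h2, fun j hj hjc => ?_⟩)))
        · by_contra hcon
          exact hr fun j hj hje => by rwa [show j = c by omega]
        · exact (hu' j hj).resolve_right fun h => hjc (H.two_unique M hu' h1 h2 hr hj h)
    · refine Or.inr (Or.inr (Or.inl ⟨?_, h1, fun j hj hjc => ?_⟩))
      · by_contra hcon
        exact hl fun j hj hje => by rwa [show j = c - 1 by omega]
      · exact (hu' j hj).resolve_left fun h => hjc (H.one_unique M hu' h1 h2 hl hj h)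
  · obtain ⟨t, ht, ht2⟩ := hall 2 (by omega) (by omega)
    have hm3' : m = 3 := by
      by_contra hne
      obtain ⟨t', ht', ht3⟩ := hall 3 (by omega) (by omega)
      have := H.intermediate_unique M hu h1 h2 ht ht' (by omega) (by omega) (by omega) (by omega)
      subst this
      omega
    subst hm3'
    have hu' : ∀ j, j < l → u j = 1 ∨ u j = 2 ∨ u j = 3 := fun j hj => by
      have := hu j hj; omega
    have huniq : ∀ j, j < l → u j = 2 → j = t := fun j hj hj2 =>
      H.intermediate_unique M hu h1 h2 hj ht (by omega) (by omega) (by omega) (by omega)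
    have hl := H.left_constant_of_intermediate M hu h1 h2 ht (by omega) (by omega)
    have hr := H.right_constant_of_intermediate M hu h1 h2 ht (by omega) (by omega)
    rcases H.singleton_of_constant M hu hm hl hr with hc | hc
    · exact Or.inr (Or.inr (Or.inr (Or.inr (Or.inr
        ⟨hc, hl s le_rfl h3, hr, hu', t, ht, ht2, huniq⟩))))
    · exact Or.inr (Or.inr (Or.inr (Or.inr (Or.inl ⟨hl, hc, h2, hu', t, ht, ht2, huniq⟩))))

end

/-! ### From permutations and blocks to sequences and indices -/

/-- A permutation of `Fin n`, as a sequence of natural numbers. -/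
def permSeq {n : ℕ} (π : Equiv.Perm (Fin n)) (p : ℕ) : ℕ :=
  if h : p < n then π ⟨p, h⟩ else p

theorem permSeq_of_lt {n : ℕ} (π : Equiv.Perm (Fin n)) {p : ℕ} (h : p < n) :
    permSeq π p = π ⟨p, h⟩ := dif_pos h

theorem permSeq_val {n : ℕ} (π : Equiv.Perm (Fin n)) (p : Fin n) : permSeq π p = π p :=
  permSeq_of_lt π p.2

/-- The default value `p` beyond `n` makes this hold on all of `ℕ`. -/
theorem permSeq_injective {n : ℕ} (π : Equiv.Perm (Fin n)) : (permSeq π).Injective := by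
  intro p q h
  unfold permSeq at h
  split_ifs at h with h1 h2 h2
  · simpa using π.injective (Fin.ext h)
  · have := (π ⟨p, h1⟩).2; omega
  · have := (π ⟨q, h2⟩).2; omega
  · exact h

/-- Every sequence can be standardized to a permutation. -/
theorem exists_permSeq (n : ℕ) (f : ℕ → ℕ) : ∃ π : Equiv.Perm (Fin n),
    ∀ p q, p < n → q < n → f p < f q → permSeq π p < permSeq π q := by
  -- `Tuple.sort` lists the positions by increasing value, so its inverse gives ranks.
  refine ⟨(Tuple.sort fun i : Fin n => f i)⁻¹, fun p q hp hq hpq => ?_⟩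
  rw [permSeq_of_lt _ hp, permSeq_of_lt _ hq, Fin.val_fin_lt]
  by_contra hcon
  have := Tuple.monotone_sort (fun i : Fin n => f i) (not_lt.1 hcon)
  simp at this
  omega

namespace POGPattern

theorem exists_isOccurrence_iff (P : POGPattern) {w : List ℕ} (hw : P.word = w) {n : ℕ}
    (π : Equiv.Perm (Fin n)) : (∃ k, P.IsOccurrence π k) ↔
      ∃ k, OccursAt (fun j => w.getD j 0) w.length P.DashAfter n (permSeq π) k := by
  subst hw
  constructor
  · rintro ⟨k, hk⟩
    refine ⟨fun j => if h : j < P.word.length then k ⟨j, h⟩ else 0, fun i j hij hj => ?_,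
      fun i hi => ?_, fun i j hi hj hij => ?_, fun i hi hd => ?_⟩
    · rw [dif_pos (hij.trans hj), dif_pos hj]
      exact hk.strictMono (by simpa using hij)
    · rw [dif_pos hi]; exact (k _).2
    · rw [dif_pos hi, dif_pos hj, permSeq_val, permSeq_val]
      refine hk.order ⟨i, hi⟩ ⟨j, hj⟩ ?_
      rw [List.getD_eq_getElem _ _ hi, List.getD_eq_getElem _ _ hj] at hij
      exact hij
    · rw [dif_pos hi, dif_pos (by omega)]
      exact hk.adjacent _ _ rfl hd
  · rintro ⟨k, hk⟩
    refine ⟨fun j => ⟨k j, hk.lt j j.2⟩, fun i j hij => hk.mono _ _ hij j.2, fun i j hij => ?_,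
      fun i j hij hd => ?_⟩
    · have := hk.order i j i.2 j.2 (by
        rw [List.getD_eq_getElem _ _ i.2, List.getD_eq_getElem _ _ j.2]
        exact hij)
      rwa [permSeq_of_lt _ (hk.lt i i.2), permSeq_of_lt _ (hk.lt j j.2)] at this
    · have h1 := j.2
      simp only [hij] at hd h1 ⊢
      exact hk.adjacent i h1 hd

theorem dashAfter_iff (P : POGPattern) (i : ℕ) :
    P.DashAfter i ↔ ∃ t, (P.blocks.take t).flatten.length = i := by
  constructor
  · rintro ⟨A, B, h, rfl⟩
    exact ⟨A.length, by simp [h]⟩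
  · rintro ⟨t, rfl⟩
    exact ⟨_, _, (List.take_append_drop t _).symm, rfl⟩

end POGPattern

theorem flatten_length_take_le (X : List (List ℕ)) (t : ℕ) :
    (X.take t).flatten.length ≤ X.flatten.length := by
  conv_rhs => rw [← List.take_append_drop t X]
  simp only [List.flatten_append, List.length_append]
  omega

/-- The lengths of the initial segments of `X ++ b :: Y`. -/
theorem exists_take_append_cons_iff (X Y : List (List ℕ)) (b : List ℕ) (i : ℕ) :
    (∃ t, ((X ++ b :: Y).take t).flatten.length = i) ↔
      (∃ t, (X.take t).flatten.length = i) ∨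
        ∃ t, X.flatten.length + b.length + (Y.take t).flatten.length = i := by
  constructor
  · rintro ⟨t, rfl⟩
    rcases le_or_gt t X.length with h | h
    · left
      exact ⟨t, by rw [List.take_append_of_le_length h]⟩
    · right
      obtain ⟨r, rfl⟩ := Nat.exists_eq_add_of_lt h
      refine ⟨r, ?_⟩
      rw [add_assoc X.length, List.take_length_add_append]
      simp only [List.take_succ_cons, List.flatten_append, List.flatten_cons, List.length_append]
      omega
  · rintro (⟨t, rfl⟩ | ⟨t, rfl⟩)
    · refine ⟨min t X.length, ?_⟩
      rw [List.take_append_of_le_length (min_le_right _ _), ← List.take_eq_take_min]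
    · refine ⟨X.length + (t + 1), ?_⟩
      rw [List.take_length_add_append]
      simp only [List.take_succ_cons, List.flatten_append, List.flatten_cons, List.length_append]
      omega

namespace POGPattern

/-- Dashes are partial sums of block lengths. As `DashAfter` also holds at 0 and at the full length,
empty σ₁ or σ₄ need no separate case. -/
theorem mergesAt {P Q σ₁ σ₄ : POGPattern} {σ₂ σ₃ : List ℕ} (h₂ : σ₂ ≠ []) (h₃ : σ₃ ≠ [])
    (hP : P.blocks = σ₁.blocks ++ σ₂ :: σ₃ :: σ₄.blocks)
    (hQ : Q.blocks = σ₁.blocks ++ (σ₂ ++ σ₃) :: σ₄.blocks) :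
    MergesAt σ₁.word.length (σ₁.word.length + σ₂.length)
      (σ₁.word.length + σ₂.length + σ₃.length) P.word.length P.DashAfter Q.DashAfter := by
  have l2 := List.length_pos_iff.2 h₂
  have l3 := List.length_pos_iff.2 h₃
  have hQd : ∀ i, Q.DashAfter i ↔ (∃ t, (σ₁.blocks.take t).flatten.length = i) ∨
      ∃ t, σ₁.word.length + (σ₂ ++ σ₃).length + (σ₄.blocks.take t).flatten.length = i := by
    intro i
    rw [dashAfter_iff, hQ, exists_take_append_cons_iff]
    rfl
  refine ⟨by omega, by omega, ?_, fun j => ?_, ?_, ?_, fun j h1 h2 => ?_⟩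
  · simp only [word, hP, List.flatten_append, List.flatten_cons, List.length_append]
    omega
  · rw [hQd, dashAfter_iff, hP, exists_take_append_cons_iff]
    simp only [word, List.length_append]
    constructor
    · rintro (h1 | ⟨t, ht⟩)
      · exact Or.inr (Or.inl h1)
      · rcases t with _ | t
        · left
          simpa using ht.symm
        · right; right
          refine ⟨t, ?_⟩
          simp only [List.take_succ_cons, List.flatten_cons, List.length_append] at ht
          omega
    · rintro (rfl | h1 | ⟨t, ht⟩)
      · exact Or.inr ⟨0, by simp⟩
      · exact Or.inl h1
      · refine Or.inr ⟨t + 1, ?_⟩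
        simp only [List.take_succ_cons, List.flatten_cons, List.length_append]
        omega
  · exact (hQd _).2 (Or.inl ⟨σ₁.blocks.length, by simp [word]⟩)
  · exact (hQd _).2 (Or.inr ⟨0, by simp; omega⟩)
  · rw [hQd]
    rintro (⟨t, ht⟩ | ⟨t, ht⟩)
    · have := flatten_length_take_le σ₁.blocks t
      simp only [word] at h1
      omega
    · simp only [List.length_append] at ht
      omega

/-- `Q` has fewer dashes, so its occurrences are occurrences of `P` and only one inclusion has
content. -/
theorem av_eq_iff {P Q : POGPattern} (hw : Q.word = P.word)
    (hPQ : ∀ j, Q.DashAfter j → P.DashAfter j) :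
    P.Av = Q.Av ↔ ∀ (n : ℕ) (π : Equiv.Perm (Fin n)),
      (∃ k, OccursAt (fun j => P.word.getD j 0) P.word.length P.DashAfter n (permSeq π) k) →
      ∃ k, OccursAt (fun j => P.word.getD j 0) P.word.length Q.DashAfter n (permSeq π) k := by
  have hQ := fun (n : ℕ) (π : Equiv.Perm (Fin n)) => Q.exists_isOccurrence_iff hw π
  constructor
  · intro h n π hP
    rw [← hQ]
    rw [← exists_isOccurrence_iff P rfl] at hP
    by_contra hcon
    have : (⟨n, π⟩ : Σ n : ℕ, Equiv.Perm (Fin n)) ∈ P.Av := h ▸ hcon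
    exact this hP
  · intro h
    ext ⟨n, π⟩
    refine not_congr ⟨fun hP => ?_, fun hQ' => ?_⟩
    · exact (hQ n π).2 (h n π ((exists_isOccurrence_iff P rfl π).1 hP))
    · obtain ⟨k, hk⟩ := (hQ n π).1 hQ'
      exact (exists_isOccurrence_iff P rfl π).2 ⟨k, hk.mono, hk.lt, hk.order,
        fun i hi hd => hk.adjacent i hi fun h => hd (hPQ _ h)⟩

end POGPattern

/-! ### Translating the six properties into statements about indices -/

theorem List.count_eq_one_iff_getD {w : List ℕ} {a : ℕ} :
    w.count a = 1 ↔ ∃ t, t < w.length ∧ w.getD t 0 = a ∧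
      ∀ j, j < w.length → w.getD j 0 = a → j = t := by
  constructor
  · intro h
    obtain ⟨t, ht, hta⟩ := List.getElem_of_mem (List.count_pos_iff.1 (by omega : 0 < w.count a))
    refine ⟨t, ht, by simpa [ht] using hta, fun j hj hja => ?_⟩
    rw [List.getD_eq_getElem _ _ hj] at hja
    by_contra hne
    have : 2 ≤ w.count a := by
      rw [← List.duplicate_iff_two_le_count, List.duplicate_iff_exists_distinct_get]
      rcases lt_or_gt_of_ne hne with hlt | hlt
      · exact ⟨⟨j, hj⟩, ⟨t, ht⟩, hlt, by simp [hja], by simp [hta]⟩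
      · exact ⟨⟨t, ht⟩, ⟨j, hj⟩, hlt, by simp [hta], by simp [hja]⟩
    omega
  · rintro ⟨t, ht, hta, huniq⟩
    rw [List.getD_eq_getElem _ _ ht] at hta
    have h1 : 0 < w.count a := List.count_pos_iff.2 (hta ▸ List.getElem_mem ht)
    by_contra hne
    have h2 : 2 ≤ w.count a := by omega
    rw [← List.duplicate_iff_two_le_count, List.duplicate_iff_exists_distinct_get] at h2
    obtain ⟨⟨i, hi⟩, ⟨j, hj⟩, hij, h3, h4⟩ := h2
    have h5 := huniq i hi (by rw [List.getD_eq_getElem _ _ hi]; simpa using h3.symm)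
    have h6 := huniq j hj (by rw [List.getD_eq_getElem _ _ hj]; simpa using h4.symm)
    simp at hij
    omega

theorem List.exists_eq_replicate_iff_getD {w : List ℕ} (hw : w ≠ []) {a : ℕ} :
    (∃ i, 1 ≤ i ∧ w = List.replicate i a) ↔ ∀ j, j < w.length → w.getD j 0 = a := by
  constructor
  · rintro ⟨i, -, rfl⟩ j hj
    simp_all
  · intro h
    refine ⟨w.length, List.length_pos_iff.2 hw, List.eq_replicate_iff.2 ⟨rfl, fun b hb => ?_⟩⟩
    obtain ⟨j, hj, rfl⟩ := List.getElem_of_mem hb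
    rw [← h j hj, List.getD_eq_getElem _ _ hj]

theorem List.eq_singleton_iff_getD {w : List ℕ} {a : ℕ} :
    w = [a] ↔ w.length = 1 ∧ w.getD 0 0 = a := by
  constructor
  · rintro rfl; simp
  · rintro ⟨h1, h2⟩
    obtain ⟨b, rfl⟩ := List.length_eq_one_iff.1 h1
    simpa using h2

theorem List.exists_eq_replicate_append_singleton {w : List ℕ} {a b : ℕ} (hw : 1 < w.length)
    (hb : w.getD (w.length - 1) 0 = b) (ha : ∀ j, j + 1 < w.length → w.getD j 0 = a) :
    ∃ i, 1 ≤ i ∧ w = List.replicate i a ++ [b] := by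
  refine ⟨w.length - 1, by omega, List.ext_getElem (by simp; omega) fun j h1 h2 => ?_⟩
  rcases eq_or_ne j (w.length - 1) with rfl | hj
  · rw [List.getElem_append_right (by simp), ← List.getD_eq_getElem _ 0, hb]
    simp
  · rw [List.getElem_append_left (by simp; omega), ← List.getD_eq_getElem _ 0, ha j (by omega)]
    simp

theorem List.exists_eq_cons_replicate {w : List ℕ} {a b : ℕ} (hw : 1 < w.length)
    (hb : w.getD 0 0 = b) (ha : ∀ j, 0 < j → j < w.length → w.getD j 0 = a) :
    ∃ i, 1 ≤ i ∧ w = b :: List.replicate i a := by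
  refine ⟨w.length - 1, by omega, List.ext_getElem (by simp; omega) fun j h1 h2 => ?_⟩
  rcases j with _ | j
  · rw [← List.getD_eq_getElem _ 0, hb]; simp
  · rw [← List.getD_eq_getElem _ 0, ha (j + 1) (by omega) h1]; simp

namespace POGPattern

theorem lettersIn_iff (P : POGPattern) (A : Set ℕ) :
    P.LettersIn A ↔ ∀ j, j < P.word.length → P.word.getD j 0 ∈ A := by
  constructor
  · intro h j hj
    rw [List.getD_eq_getElem _ _ hj]
    exact h _ (List.getElem_mem hj)
  · intro h x hx
    obtain ⟨j, hj, rfl⟩ := List.getElem_of_mem hx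
    rw [← List.getD_eq_getElem _ 0]
    exact h j hj

theorem hasSlidingShape_iff {P σ₁ σ₄ : POGPattern} {σ₂ σ₃ : List ℕ} (h₂ : σ₂ ≠ []) (h₃ : σ₃ ≠ [])
    (hw : P.word = σ₁.word ++ (σ₂ ++ (σ₃ ++ σ₄.word))) :
    HasSlidingShape (fun j => P.word.getD j 0) σ₁.word.length (σ₁.word.length + σ₂.length)
      (σ₁.word.length + σ₂.length + σ₃.length) P.word.length ↔
      ((∃ i, 1 ≤ i ∧ σ₂ = List.replicate i 1) ∧ σ₃ = [2] ∧ P.LettersIn {1, 2}) ∨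
      (σ₂ = [1] ∧ (∃ j, 1 ≤ j ∧ σ₃ = List.replicate j 2) ∧ P.LettersIn {1, 2}) ∨
      ((∃ i, 1 ≤ i ∧ σ₂ = List.replicate i 2 ++ [1]) ∧ (∃ j, 1 ≤ j ∧ σ₃ = List.replicate j 2) ∧
        P.LettersIn {1, 2} ∧ P.word.count 1 = 1) ∨
      ((∃ i, 1 ≤ i ∧ σ₂ = List.replicate i 1) ∧ (∃ j, 1 ≤ j ∧ σ₃ = 2 :: List.replicate j 1) ∧
        P.LettersIn {1, 2} ∧ P.word.count 2 = 1) ∨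
      ((∃ i, 1 ≤ i ∧ σ₂ = List.replicate i 1) ∧ σ₃ = [3] ∧
        P.LettersIn {1, 2, 3} ∧ P.word.count 2 = 1) ∨
      (σ₂ = [1] ∧ (∃ j, 1 ≤ j ∧ σ₃ = List.replicate j 3) ∧
        P.LettersIn {1, 2, 3} ∧ P.word.count 2 = 1) := by
  have l2 := List.length_pos_iff.2 h₂
  have l3 := List.length_pos_iff.2 h₃
  have hlen : σ₁.word.length + σ₂.length + σ₃.length ≤ P.word.length := by
    simp only [hw, List.length_append]; omega
  have hu2 : ∀ j, j < σ₂.length → P.word.getD (σ₁.word.length + j) 0 = σ₂.getD j 0 := by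
    intro j hj
    rw [hw, List.getD_append_right _ _ _ _ (by omega), Nat.add_sub_cancel_left,
      List.getD_append _ _ _ _ hj]
  have hu3 : ∀ j, j < σ₃.length →
      P.word.getD (σ₁.word.length + σ₂.length + j) 0 = σ₃.getD j 0 := by
    intro j hj
    rw [hw, List.getD_append_right _ _ _ _ (by omega), List.getD_append_right _ _ _ _ (by omega),
      List.getD_append _ _ _ _ (by omega)]
    congr 1
    omega
  obtain ⟨u, hu⟩ : ∃ u : ℕ → ℕ, ∀ j, P.word.getD j 0 = u j := ⟨_, fun _ => rfl⟩
  simp only [lettersIn_iff, List.count_eq_one_iff_getD, List.exists_eq_replicate_iff_getD h₂,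
    List.exists_eq_replicate_iff_getD h₃, List.eq_singleton_iff_getD, Set.mem_insert_iff,
    Set.mem_singleton_iff]
  have hr2 : ∀ a, (∀ j, j < σ₂.length → σ₂.getD j 0 = a) ↔
      ∀ j, σ₁.word.length ≤ j → j < σ₁.word.length + σ₂.length → u j = a := fun a =>
    ⟨fun h j h1 h2 => by
      obtain ⟨r, rfl⟩ := Nat.exists_eq_add_of_le h1
      rw [← hu, hu2 r (by omega), h r (by omega)],
    fun h j hj => by rw [← hu2 j hj, hu, h _ (by omega) (by omega)]⟩
  have hr3 : ∀ a, (∀ j, j < σ₃.length → σ₃.getD j 0 = a) ↔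
      ∀ j, σ₁.word.length + σ₂.length ≤ j → j < σ₁.word.length + σ₂.length + σ₃.length →
        u j = a := fun a =>
    ⟨fun h j h1 h2 => by
      obtain ⟨r, rfl⟩ := Nat.exists_eq_add_of_le h1
      rw [← hu, hu3 r (by omega), h r (by omega)],
    fun h j hj => by rw [← hu3 j hj, hu, h _ (by omega) (by omega)]⟩
  have hs2 : ∀ a, σ₂.length = 1 ∧ σ₂.getD 0 0 = a ↔
      σ₁.word.length + σ₂.length = σ₁.word.length + 1 ∧ u σ₁.word.length = a := fun a => by
    rw [← hu2 0 l2, hu, add_zero, add_right_inj]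
  have hs3 : ∀ a, σ₃.length = 1 ∧ σ₃.getD 0 0 = a ↔
      σ₁.word.length + σ₂.length + σ₃.length = σ₁.word.length + σ₂.length + 1 ∧
        u (σ₁.word.length + σ₂.length) = a := fun a => by
    rw [← hu3 0 l3, hu, add_zero, add_right_inj]
  simp only [hr2, hr3, hs2, hs3, hu, HasSlidingShape, and_assoc]
  -- Only (3) and (4) differ in form: there the uniqueness of the exceptional letter already
  -- determines all the others.
  refine or_congr Iff.rfl (or_congr Iff.rfl (or_congr ?_ (or_congr ?_ Iff.rfl)))
  · constructor
    · rintro ⟨h1, h2, h3⟩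
      refine ⟨List.exists_eq_replicate_append_singleton (by omega) ?_ fun j hj => ?_,
        fun j h4 h5 => h3 j (by omega) (by omega), fun j hj => ?_, _, ?_, h2, fun j hj hj1 => ?_⟩
      · rw [← hu2 _ (by omega), hu, ← Nat.add_sub_assoc (by omega), h2]
      · rw [← hu2 _ (by omega), hu, h3 _ (by omega) (by omega)]
      · by_cases hjc : j = σ₁.word.length + σ₂.length - 1
        · exact Or.inl (hjc ▸ h2)
        · exact Or.inr (h3 j hj hjc)
      · omega
      · by_contra hjc
        have := h3 j hj hjc
        omega
    · rintro ⟨⟨i, hi, hσ⟩, -, h3, t, ht, ht1, huniq⟩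
      have hlen2 : σ₂.length = i + 1 := by simp [hσ]
      have hlast : u (σ₁.word.length + σ₂.length - 1) = 1 := by
        rw [Nat.add_sub_assoc (by omega), ← hu, hu2 _ (by omega), hlen2, hσ]
        simp
      refine ⟨by omega, hlast, fun j hj hjc => (h3 j hj).resolve_left fun hj1 => hjc ?_⟩
      rw [huniq j hj hj1, huniq _ (by omega) hlast]
  · constructor
    · rintro ⟨h1, h2, h3⟩
      refine ⟨fun j h4 h5 => h3 j (by omega) (by omega),
        List.exists_eq_cons_replicate (by omega) ?_ fun j hj0 hj => ?_, fun j hj => ?_,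
        _, ?_, h2, fun j hj hj1 => ?_⟩
      · rw [← hu3 _ (by omega), hu, add_zero, h2]
      · rw [← hu3 _ (by omega), hu, h3 _ (by omega) (by omega)]
      · by_cases hjc : j = σ₁.word.length + σ₂.length
        · exact Or.inr (hjc ▸ h2)
        · exact Or.inl (h3 j hj hjc)
      · omega
      · by_contra hjc
        have := h3 j hj hjc
        omega
    · rintro ⟨-, ⟨i, hi, hσ⟩, h3, t, ht, ht1, huniq⟩
      have hlen3 : σ₃.length = i + 1 := by simp [hσ]
      have hfirst : u (σ₁.word.length + σ₂.length) = 2 := by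
        have := hu3 0 l3
        rw [hu, add_zero] at this
        rw [this, hσ]
        simp
      refine ⟨by omega, hfirst, fun j hj hjc => (h3 j hj).resolve_right fun hj1 => hjc ?_⟩
      rw [huniq j hj hj1, huniq _ (by omega) hfirst]

end POGPattern

/-! ### The characterization -/

theorem mainTheorem1 (P Q σ₁ σ₄ : POGPattern) (σ₂ σ₃ : List ℕ) (h₂ : σ₂ ≠ []) (h₃ : σ₃ ≠ [])
    (hP : P = ((σ₁.dash (.contiguous σ₂ h₂)).dash (.contiguous σ₃ h₃)).dash σ₄)
    (hQ : Q = (σ₁.dash (.contiguous (σ₂ ++ σ₃) (List.append_ne_nil_of_left_ne_nil h₂ σ₃))).dash σ₄)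
    (hnorm : P.Normalized) (hnontriv : P.Nontrivial)
    (hle : σ₂.getLast h₂ ≤ σ₃.head h₃) :
    P.Av = Q.Av ↔
      -- (1) `σ₂ = 1…1`, `σ₃ = 2`
      ((∃ i, 1 ≤ i ∧ σ₂ = List.replicate i 1) ∧ σ₃ = [2] ∧ P.LettersIn {1, 2}) ∨
      -- (2) `σ₂ = 1`, `σ₃ = 2…2`
      (σ₂ = [1] ∧ (∃ j, 1 ≤ j ∧ σ₃ = List.replicate j 2) ∧ P.LettersIn {1, 2}) ∨
      -- (3) `σ₂ = 2…21`, `σ₃ = 2…2`, and `1` appears once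
      ((∃ i, 1 ≤ i ∧ σ₂ = List.replicate i 2 ++ [1]) ∧ (∃ j, 1 ≤ j ∧ σ₃ = List.replicate j 2) ∧
        P.LettersIn {1, 2} ∧ P.word.count 1 = 1) ∨
      -- (4) `σ₂ = 1…1`, `σ₃ = 21…1`, and `2` appears once
      ((∃ i, 1 ≤ i ∧ σ₂ = List.replicate i 1) ∧ (∃ j, 1 ≤ j ∧ σ₃ = 2 :: List.replicate j 1) ∧
        P.LettersIn {1, 2} ∧ P.word.count 2 = 1) ∨
      -- (5) `σ₂ = 1…1`, `σ₃ = 3`, and `2` appears once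
      ((∃ i, 1 ≤ i ∧ σ₂ = List.replicate i 1) ∧ σ₃ = [3] ∧
        P.LettersIn {1, 2, 3} ∧ P.word.count 2 = 1) ∨
      -- (6) `σ₂ = 1`, `σ₃ = 3…3`, and `2` appears once
      (σ₂ = [1] ∧ (∃ j, 1 ≤ j ∧ σ₃ = List.replicate j 3) ∧
        P.LettersIn {1, 2, 3} ∧ P.word.count 2 = 1) := by
  have hPb : P.blocks = σ₁.blocks ++ σ₂ :: σ₃ :: σ₄.blocks := by
    simp [hP, POGPattern.dash, POGPattern.contiguous]
  have hQb : Q.blocks = σ₁.blocks ++ (σ₂ ++ σ₃) :: σ₄.blocks := by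
    simp [hQ, POGPattern.dash, POGPattern.contiguous]
  have hw : P.word = σ₁.word ++ (σ₂ ++ (σ₃ ++ σ₄.word)) := by
    simp [POGPattern.word, hPb]
  have hwQ : Q.word = P.word := by
    simp [POGPattern.word, hPb, hQb]
  have M := POGPattern.mergesAt h₂ h₃ hPb hQb
  have l2 := List.length_pos_iff.2 h₂
  have l3 := List.length_pos_iff.2 h₃
  rw [POGPattern.av_eq_iff hwQ fun j hj => (M.dash_iff j).2 (Or.inr hj),
    ← POGPattern.hasSlidingShape_iff h₂ h₃ hw]
  constructor
  · intro h
    obtain ⟨m, hm⟩ := hnorm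
    obtain ⟨x, hx, y, hy, hxy⟩ := hnontriv
    have hx' := (hm x).1 hx
    have hy' := (hm y).1 hy
    refine Forces.hasSlidingShape (m := m) (fun n f k hk => ?_) M (fun j hj => ?_)
      (fun a h1 h2 => ?_) (by omega) ?_
    -- Standardizing `f` breaks its ties somehow, which is why `Forces` allows an arbitrary
    -- refinement.
    · obtain ⟨π, hπ⟩ := exists_permSeq n f
      obtain ⟨k', hk'⟩ := h n π ⟨k, hk.mono, hk.lt,
        fun i j hi hj hij => hπ _ _ (hk.lt j hj) (hk.lt i hi) (hk.order i j hi hj hij),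
        hk.adjacent⟩
      exact ⟨permSeq π, k', hπ, hk'⟩
    · rw [List.getD_eq_getElem _ _ hj, ← hm]
      exact List.getElem_mem hj
    · obtain ⟨j, hj, hja⟩ := List.getElem_of_mem ((hm a).2 ⟨h1, h2⟩)
      exact ⟨j, hj, by rw [List.getD_eq_getElem _ _ hj, hja]⟩
    · convert hle using 1
      · rw [hw, List.getD_append_right _ _ _ _ (by omega), List.getD_append _ _ _ _ (by omega),
          List.getLast_eq_getElem, List.getD_eq_getElem _ _ (by omega)]
        congr 1
        omega
      · rw [hw, List.getD_append_right _ _ _ _ (by omega),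
          List.getD_append_right _ _ _ _ (by omega), List.getD_append _ _ _ _ (by omega),
          List.head_eq_getElem, List.getD_eq_getElem _ _ (by omega)]
        congr 1
        omega
  · rintro S n π ⟨k, hk⟩
    exact S.exists_occursAt M (permSeq_injective π) hk
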